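/- A signed graph $\Gamma=(G,\sigma)$ is a finite simple graph $G$ together with a function $\sigma:E(G)\to\{+1,-1\}$. Its signed adjacency matrix $\mathcal S(\Gamma)=(s_{ij})$ is the real symmetric matrix with $s_{ij}=\sigma(ij)$ if the vertices $i,j$ are adjacent and $s_{ij}=0$ otherwise, and its $\mathcal S$-spectral radius $\rho_{\mathcal S}(\Gamma)$ is the largest absolute value of an eigenvalue of $\mathcal S(\Gamma)$. A caterpillar is a tree from which the removal of all pendant vertices (vertices of degree one) leaves a (possibly empty) path; a signed caterpillar is a signed graph whose underlying graph is a caterpillar. **Proposition.** For every real $\lambda\ge\sqrt{2+\sqrt5}$ there is a sequence $(\Gamma_k)_{k\in\mathbb N}$ of signed caterpillars such that $\rho_{\mathcal S}(\Gamma_i)\ne\rho_{\mathcal S}(\Gamma_j)$ whenever $i\ne j$, and $\lim_{k\to\infty}\rho_{\mathcal S}(\Gamma_k)=\lambda$. That is, every such $\lambda$ is a limit point of the $\mathcal S$-spectral radii of signed caterpillars. -/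

import Mathlib

open Filter Topology

/-- A signed graph on the vertex set `V`: a simple graph together with a sign `+1` or `-1`
for each of its edges. -/
structure SignedGraph (V : Type*) where
  /-- the underlying unsigned graph -/
  graph : SimpleGraph V
  /-- the signature; `ℤˣ` is the two-element set of signs -/
  sign : graph.edgeSet → ℤˣ

/-- A vertex is pendant if it has exactly one neighbour. -/
def SimpleGraph.IsPendantVertex {V : Type*} (G : SimpleGraph V) (v : V) : Prop :=
  ∃! w, G.Adj v w

/-- A caterpillar is a tree such that the subgraph induced on the non-pendant vertices is a path.
The path on `0` vertices is allowed, so that the single edge is a caterpillar. -/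
def SimpleGraph.IsCaterpillar {V : Type*} (G : SimpleGraph V) : Prop :=
  G.IsTree ∧ ∃ m : ℕ,
    Nonempty (G.induce {v | ¬ G.IsPendantVertex v} ≃g SimpleGraph.pathGraph m)

namespace SignedGraph

open Classical in
/-- The signed adjacency matrix: the entry at `(i, j)` is the sign of the edge `ij` if `i` and `j`
are adjacent, and `0` otherwise. -/
noncomputable def adjMatrix {V : Type*} (Γ : SignedGraph V) : Matrix V V ℝ :=
  Matrix.of fun i j => if h : Γ.graph.Adj i j then ((Γ.sign ⟨s(i, j), h⟩ : ℤ) : ℝ) else 0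

theorem adjMatrix_isHermitian {V : Type*} (Γ : SignedGraph V) : Γ.adjMatrix.IsHermitian := by
  ext i j
  by_cases h : Γ.graph.Adj i j
  · have e : (⟨s(j, i), h.symm⟩ : Γ.graph.edgeSet) = ⟨s(i, j), h⟩ := Subtype.ext Sym2.eq_swap
    simp [adjMatrix, h, h.symm, e]
  · have h' : ¬ Γ.graph.Adj j i := fun k => h k.symm
    simp [adjMatrix, h, h']

/-- The spectral radius of the signed adjacency matrix. The matrix is real symmetric, so all its
eigenvalues are real and its real spectrum is the set of all of them. -/
noncomputable def spectralRadius {V : Type*} [Fintype V] [DecidableEq V] (Γ : SignedGraph V) : ℝ :=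
  (_root_.spectralRadius ℝ Γ.adjMatrix).toReal

/-- The spectral radius is the largest absolute value of an eigenvalue. -/
theorem isGreatest_spectralRadius {V : Type*} [Fintype V] [DecidableEq V] [Nonempty V]
    (Γ : SignedGraph V) :
    IsGreatest ((fun μ : ℝ => |μ|) '' spectrum ℝ Γ.adjMatrix) Γ.spectralRadius := by
  have hs := Γ.adjMatrix_isHermitian.spectrum_real_eq_range_eigenvalues
  have hfin : (spectrum ℝ Γ.adjMatrix).Finite := by rw [hs]; exact Set.finite_range _
  have hne : (spectrum ℝ Γ.adjMatrix).Nonempty := by rw [hs]; exact Set.range_nonempty _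
  obtain ⟨μ, hμ, hmax⟩ := hfin.exists_maximalFor (fun μ : ℝ => |μ|) _ hne
  have hmax' : ∀ ν ∈ spectrum ℝ Γ.adjMatrix, |ν| ≤ |μ| := fun ν hν =>
    (le_total |ν| |μ|).elim id (fun h => hmax hν h)
  have hval : Γ.spectralRadius = |μ| := by
    have : _root_.spectralRadius ℝ Γ.adjMatrix = (‖μ‖₊ : ENNReal) := by
      refine le_antisymm (iSup₂_le fun ν hν => ?_)
        (le_iSup₂ (f := fun (k : ℝ) (_ : k ∈ spectrum ℝ Γ.adjMatrix) => (‖k‖₊ : ENNReal)) μ hμ)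
      exact ENNReal.coe_le_coe.2 (hmax' ν hν)
    rw [spectralRadius, this]
    simp
  rw [hval]
  refine ⟨⟨μ, hμ, rfl⟩, ?_⟩
  rintro _ ⟨ν, hν, rfl⟩
  exact hmax' ν hν

end SignedGraph

/-! All signs can be taken positive. It suffices that for `lam > √(2 + √5)` and `0 < lam' < lam`
some caterpillar has spectral radius in `[lam', lam]`. Applied just above the given value, this
yields a strictly decreasing sequence of radii, which also covers `lam = √(2 + √5)`.

Eliminating the leaves, the eigenvalue equation becomes a spine recurrence whose consecutive ratios
satisfy `b (i + 1) = lam - r (i + 1) / lam - 1 / b i`. Let `θ < t` be the fixed points of `x ↦ lam -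
1 / x`. Attaching leaves greedily keeps `b i` in `[θ, θ + 1 / lam)`. The condition on `lam` says
exactly that this window lies below `t`.

Cutting the spine and adding one leaf at its end gives a positive supersolution at `lam`, hence the
upper bound. For the lower bound, suppose the recurrence with the same leaf counts stayed positive
at `lam'`. In the coordinate `(x - θ) / (t - x)` the Möbius map is a scaling, so it preserves the
quotient of the two orbits; the leaf shifts do not decrease it, and the deficit `lam - lam'`
enlarges it by a fixed factor. But the quotient is bounded (`not_forall_pos_of_greedy`). So the
solution at `lam'` reaches a nonpositive value, and truncating it there gives a subsolution. -/

/-! ### Spine recurrence and greedy leaf counts -/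

/-- The values along the spine of the solution of the eigenvalue equation for `μ` on the infinite
caterpillar whose `i`-th spine vertex carries `r i` leaves. -/
noncomputable def spineSolution (μ : ℝ) (r : ℕ → ℕ) : ℕ → ℝ
  | 0 => 0
  | 1 => 1
  | n + 2 => (μ - r n / μ) * spineSolution μ r (n + 1) - spineSolution μ r n

/-- Each `r i` is the largest number of leaves keeping the ratio at least `θ`. One more leaf costs
`1 / lam`, which bounds the overshoot; the next ratio before subtracting leaves is at least `lam - 1
/ θ = θ`, so the choice never gets stuck. -/
theorem exists_greedy_leaf_counts {lam θ t : ℝ} (hlam : 0 < lam) (hθ : 0 < θ) (hsum : t + θ = lam)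
    (hprod : t * θ = 1) :
    ∃ (r : ℕ → ℕ) (b : ℕ → ℝ), (∀ i, θ ≤ b i) ∧ (∀ i, b i < θ + 1 / lam) ∧
      b 0 = lam - r 0 / lam ∧ (∀ i, b (i + 1) = lam - r (i + 1) / lam - 1 / b i) ∧
      (1 ≤ lam * t → 1 ≤ r 0) := by
  have key : ∀ z : ℝ, θ ≤ z → θ ≤ z - ⌊lam * (z - θ)⌋₊ / lam ∧
      z - ⌊lam * (z - θ)⌋₊ / lam < θ + 1 / lam := by
    intro z hz
    have h1 := Nat.floor_le (mul_nonneg hlam.le (sub_nonneg.2 hz))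
    have h2 := Nat.lt_floor_add_one (lam * (z - θ))
    constructor
    · have : (⌊lam * (z - θ)⌋₊ : ℝ) / lam ≤ z - θ := by
        rw [div_le_iff₀ hlam]; linarith
      linarith
    · have : z - θ < (⌊lam * (z - θ)⌋₊ + 1 : ℝ) / lam := by
        rw [lt_div_iff₀ hlam]; linarith
      rw [add_div] at this
      linarith
  let b : ℕ → ℝ := fun n => Nat.rec (lam - ⌊lam * (lam - θ)⌋₊ / lam)
    (fun _ x => lam - 1 / x - ⌊lam * (lam - 1 / x - θ)⌋₊ / lam) n
  let r : ℕ → ℕ := fun n => Nat.casesOn n ⌊lam * (lam - θ)⌋₊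
    (fun k => ⌊lam * (lam - 1 / b k - θ)⌋₊)
  have hinv : 1 / θ = t := by field_simp; linarith
  have ht : 0 < t := by rw [← hinv]; positivity
  have hb : ∀ i, θ ≤ b i ∧ b i < θ + 1 / lam := by
    intro i
    induction i with
    | zero => exact key lam (by linarith)
    | succ i ih =>
      refine key (lam - 1 / b i) ?_
      have := one_div_le_one_div_of_le hθ ih.1
      linarith
  refine ⟨r, b, fun i => (hb i).1, fun i => (hb i).2, rfl, fun i => ?_, fun h => ?_⟩
  · change lam - 1 / b i - ⌊lam * (lam - 1 / b i - θ)⌋₊ / lam =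
      lam - ⌊lam * (lam - 1 / b i - θ)⌋₊ / lam - 1 / b i
    ring
  · change 1 ≤ ⌊lam * (lam - θ)⌋₊
    refine Nat.le_floor ?_
    rw [← hsum] at h ⊢
    push_cast
    linarith

/-! ### Comparison of the orbits at two values -/

/-- A positive sequence which stays below the orbit of `x ↦ lam - δ - 1 / x` is bounded away from
the repelling fixed point `θ` of `x ↦ lam - 1 / x`. -/
theorem lt_of_forall_pos_of_le_sub_inv {lam θ t δ : ℝ} (hθ : 0 < θ) (hθ1 : θ ≤ 1)
    (hsum : t + θ = lam) (hprod : t * θ = 1) (hδ : 0 < δ) {c : ℕ → ℝ} (hc : ∀ i, 0 < c i)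
    (hstep : ∀ i, c (i + 1) ≤ lam - δ - 1 / c i) (i : ℕ) : θ + δ * θ ^ 2 < c i := by
  have hinv : 1 / θ = t := by field_simp; linarith
  have hlow : ∀ i, θ < c i := by
    intro i
    by_contra! hi
    -- Below `θ` the map `x ↦ lam - 1 / x` lies under the diagonal, so each step loses at least `δ`.
    have hdec : ∀ n : ℕ, c (i + n) ≤ θ - n * δ := by
      intro n
      induction n with
      | zero => simpa using hi
      | succ n ih =>
        have h1 := hstep (i + n)
        have h0 := hc (i + n)
        have h3 : c (i + n) ≤ θ := le_trans ih (by have : 0 ≤ (n : ℝ) * δ := by positivity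
                                                   linarith)
        have h2 : t + (θ - c (i + n)) ≤ 1 / c (i + n) := by
          rw [le_div_iff₀ h0]
          have ht : t ≥ 1 := by rw [← hinv]; rw [ge_iff_le, le_div_iff₀ hθ]; linarith
          nlinarith [mul_nonneg (sub_nonneg.2 h3) (sub_nonneg.2 (h3.trans (hθ1.trans ht)))]
        push_cast
        rw [← add_assoc]
        linarith
    obtain ⟨n, hn⟩ := exists_nat_gt (θ / δ)
    rw [div_lt_iff₀ hδ] at hn
    linarith [hdec n, hc (i + n)]
  by_contra! hi
  have h1 := hstep i
  have h2 := hlow (i + 1)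
  -- A term within `δ * θ ^ 2` of `θ` would have its successor at most `θ`.
  have h3 : t - δ ≤ 1 / c i := by
    rw [le_div_iff₀ (hc i)]
    rcases le_total t δ with h | h
    · nlinarith [hc i]
    · calc (t - δ) * c i ≤ (t - δ) * (θ + δ * θ ^ 2) :=
            mul_le_mul_of_nonneg_left hi (by linarith)
        _ = t * θ + δ * θ * (t * θ) - δ * θ - δ ^ 2 * θ ^ 2 := by ring
        _ ≤ 1 := by rw [hprod]; nlinarith [sq_nonneg (δ * θ)]
  linarith

/-- The ratio of the coordinates `s / (T - s)` and `s' / (T - s')` grows when both points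
are shifted down by the same amount `p`, as long as the points stay in the left part of `(0, T)`. -/
theorem ratio_le_ratio_of_shift {T x x' p : ℝ} (hT : 0 < T) (hp : 0 ≤ p) (hx' : 0 < x')
    (hxx : x' ≤ x) (hxp : x + p < T)
    (hx : p = 0 ∨ 2 * x + p ≤ T) :
    (x + p) * (T - (x' + p)) / ((T - (x + p)) * (x' + p)) ≤ x * (T - x') / ((T - x) * x') := by
  rw [div_le_div_iff₀ (mul_pos (by linarith) (by linarith)) (mul_pos (by linarith) hx')]
  have : x * (T - x') * ((T - (x + p)) * (x' + p)) - (x + p) * (T - (x' + p)) * ((T - x) * x') =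
      p * T * ((x - x') * (T - p - x - x')) := by ring
  have h2 : 0 ≤ p * T * ((x - x') * (T - p - x - x')) := by
    rcases hx with rfl | hx
    · simp
    · exact mul_nonneg (by positivity) (mul_nonneg (by linarith) (by linarith))
  linarith

/-- The ratio of the coordinates `s / (t - θ - s)` of two orbits of the greedy dynamics grows by a
fixed factor at each step if the lower orbit loses at least `δ`. -/
theorem ratio_growth {lam θ t δ s s' y y' : ℝ} {r : ℕ} (hθ : 0 < θ)
    (hsum : t + θ = lam) (hprod : t * θ = 1) (hcrit : 1 / lam < t - θ) (hδ : 0 < δ)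
    (hs' : 0 < s') (hss : s' ≤ s) (hs : s < 1 / lam) (hyy : y' ≤ y) (hy' : 0 < y')
    (hy : y < 1 / lam)
    (hstep : θ + y = lam - r / lam - 1 / (θ + s))
    (hstep' : θ + y' ≤ lam - δ - r / lam - 1 / (θ + s')) :
    s * (t - θ - s') / ((t - θ - s) * s') * (1 + δ / (t - θ)) ≤
      y * (t - θ - y') / ((t - θ - y) * y') := by
  have ht : 0 < t := by nlinarith
  have hlam : 0 < lam := by linarith
  have hT : 0 < t - θ := lt_trans (by positivity) hcrit
  set T := t - θ with hTdef
  have hsT : s < T := hs.trans hcrit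
  have hinv : 1 / θ = t := by field_simp; linarith
  have himg : ∀ u, 0 < u → t - 1 / (θ + u) = u / (θ * (θ + u)) := by
    intro u hu
    rw [← hinv]; field_simp; ring
  have hcomp : ∀ u, 0 < u → T - u / (θ * (θ + u)) = θ ^ 2 * (T - u) / (θ * (θ + u)) := by
    intro u hu
    have : θ * (θ + u) ≠ 0 := by positivity
    rw [eq_div_iff this, sub_mul, div_mul_cancel₀ _ this, hTdef]
    linear_combination u * hprod
  have hs0 : 0 < s := hs'.trans_le hss
  set P := s / (θ * (θ + s)) with hP
  set P' := s' / (θ * (θ + s')) with hP'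
  have hP0 : 0 < P := by positivity
  have hP'0 : 0 < P' := by positivity
  have e1 : y = P - r / lam := by have := himg s hs0; linarith
  have e2 : y' ≤ P' - δ - r / lam := by have := himg s' hs'; linarith
  have hmono : P' ≤ P := by
    rw [hP, hP', ← himg s hs0, ← himg s' hs']
    have := one_div_le_one_div_of_le (by positivity : 0 < θ + s') (by linarith : θ + s' ≤ θ + s)
    linarith
  have hPT : P < T := by
    have : 0 < T - P := by
      rw [hcomp s hs0]; exact div_pos (mul_pos (by positivity) (by linarith)) (by positivity)
    linarith
  -- The Möbius map multiplies both coordinates by `1 / θ ^ 2`, which cancels.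
  have hratio : s * (T - s') / ((T - s) * s') = P * (T - P') / ((T - P) * P') := by
    rw [hcomp s hs0, hcomp s' hs']
    have : T - s ≠ 0 := by linarith
    rw [hP, hP']; field_simp
  set x' := P' - r / lam with hx'
  have hx'0 : 0 < x' := by linarith
  have hshift : P * (T - P') / ((T - P) * P') ≤ y * (T - x') / ((T - y) * x') := by
    have eP : P = y + r / lam := by linarith
    have eP' : P' = x' + r / lam := by rw [hx']; ring
    rw [eP, eP']
    refine ratio_le_ratio_of_shift hT (by positivity) hx'0 (by linarith) (by linarith) ?_
    rcases Nat.eq_zero_or_pos r with h | h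
    · left; simp [h]
    · right
      have hr : 1 / lam ≤ r / lam := by gcongr; exact_mod_cast h
      -- As `s < 1 / lam`, the endpoint `s = 1 / lam` is the worst case; there the claim becomes `θ
      -- ^ 4 + θ ^ 2 ≤ 1`, which follows from `hcrit`.
      have : 2 * P ≤ T + 1 / lam := by
        set q := 1 / lam with hq
        have hq0 : 0 < q := by positivity
        have hlq : lam * q = 1 := by rw [hq]; field_simp
        have hle : lam - q ≤ 2 / (θ + q) := by
          rw [le_div_iff₀ (by positivity)]
          have h2 : 1 < t ^ 2 - θ ^ 2 := by
            have h3 : 1 < lam * T := by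
              have := (mul_lt_mul_iff_right₀ hlam).2 hcrit
              rwa [hlq] at this
            rw [← hsum, hTdef] at h3
            linarith
          have h4 : θ ^ 4 + θ ^ 2 < 1 := by
            have := (mul_lt_mul_iff_right₀ (pow_pos hθ 2)).2 h2
            have e : θ ^ 2 * (t ^ 2 - θ ^ 2) = 1 - θ ^ 4 := by
              linear_combination (t * θ + 1) * hprod
            linarith
          have hlθ : lam * θ = 1 + θ ^ 2 := by rw [← hsum]; linear_combination hprod
          have h5 : lam ^ 2 * (θ ^ 2 - q * θ - q ^ 2) ≤ 0 := by
            have e : lam ^ 2 * (θ ^ 2 - q * θ - q ^ 2) = θ ^ 4 + θ ^ 2 - 1 := by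
              linear_combination (lam * θ + θ ^ 2) * hlθ - (lam * θ + lam * q + 1) * hlq
            linarith
          have h6 : θ ^ 2 - q * θ - q ^ 2 ≤ 0 := by
            by_contra! h
            exact absurd h5 (not_le.2 (by positivity))
          nlinarith
        have hle2 := one_div_le_one_div_of_le (by positivity : 0 < θ + s)
          (by linarith : θ + s ≤ θ + q)
        have e3 := himg s hs0
        have e4 : 2 / (θ + q) = 2 * (1 / (θ + q)) := by ring
        rw [hP, ← e3]
        linarith
      linarith
  have hyT : y < T := hy.trans hcrit
  have hdrop : y * (T - x') / ((T - y) * x') * (1 + δ / T) ≤ y * (T - y') / ((T - y) * y') := by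
    have hTd : 1 + δ / T = (T + δ) / T := by field_simp
    rw [hTd, div_mul_div_comm, div_le_div_iff₀ (by have : 0 < T - y := by linarith
                                                   positivity)
      (mul_pos (by linarith) hy')]
    have hy0 : 0 < y := by linarith
    have hTy : 0 < T - y := by linarith
    have hx'T : x' < T := by linarith
    have : (T - x') * (T + δ) * y' ≤ (T - y') * (x' * T) := by
      calc (T - x') * (T + δ) * y' ≤ (T - x') * (T + δ) * (x' - δ) := by
            refine mul_le_mul_of_nonneg_left (by linarith) (mul_nonneg (by linarith) (by linarith))
        _ ≤ (T - (x' - δ)) * (x' * T) := by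
            have : 0 ≤ δ * x' * T + δ * (T - x') ^ 2 + (T - x') * δ ^ 2 := by
              have := sub_pos.2 hx'T
              positivity
            linarith
        _ ≤ (T - y') * (x' * T) := by
            refine mul_le_mul_of_nonneg_right (by linarith) (by positivity)
    calc y * (T - x') * (T + δ) * ((T - y) * y') = y * (T - y) * ((T - x') * (T + δ) * y') := by ring
      _ ≤ y * (T - y) * ((T - y') * (x' * T)) := by gcongr
      _ = _ := by ring
  calc _ ≤ y * (T - x') / ((T - y) * x') * (1 + δ / T) := by
        rw [hratio]; exact mul_le_mul_of_nonneg_right hshift (by positivity)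
    _ ≤ _ := hdrop

/-- For `lam > √(2 + √5)` the greedy caterpillar admits no positive solution at any smaller
value `lam'`. -/
theorem not_forall_pos_of_greedy {lam lam' θ t : ℝ} {r : ℕ → ℕ} {b c : ℕ → ℝ} (hθ : 0 < θ)
    (hθ1 : θ < 1) (hsum : t + θ = lam) (hprod : t * θ = 1) (hcrit : 1 / lam < t - θ)
    (hlam' : 0 < lam') (hlt : lam' < lam)
    (hblt : ∀ i, b i < θ + 1 / lam)
    (hb0 : b 0 = lam - r 0 / lam) (hb : ∀ i, b (i + 1) = lam - r (i + 1) / lam - 1 / b i)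
    (hc0 : c 0 = lam' - r 0 / lam') (hc : ∀ i, c (i + 1) = lam' - r (i + 1) / lam' - 1 / c i) :
    ¬ ∀ i, 0 < c i := by
  intro hpos
  have hr : ∀ i, (r i : ℝ) / lam ≤ r i / lam' := fun i => by gcongr
  set δ := lam - lam' with hδdef
  have hδ : 0 < δ := sub_pos.2 hlt
  have hT : 0 < t - θ := lt_trans (by have : 0 < lam := hlam'.trans hlt
                                      positivity) hcrit
  have hcθ := lt_of_forall_pos_of_le_sub_inv hθ hθ1.le hsum hprod hδ hpos (fun i => by
    rw [hc i]
    have : 0 ≤ (r (i + 1) : ℝ) / lam' := by positivity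
    linarith)
  have hε : 0 < δ * θ ^ 2 := by positivity
  have hcb : ∀ i, c i ≤ b i := by
    intro i
    induction i with
    | zero => rw [hc0, hb0]; linarith [hr 0]
    | succ i ih =>
      rw [hc, hb]
      have := one_div_le_one_div_of_le (hpos i) ih
      linarith [hr (i + 1)]
  set ratio : ℕ → ℝ := fun i =>
    (b i - θ) * (t - θ - (c i - θ)) / ((t - θ - (b i - θ)) * (c i - θ)) with hratio
  have hs' : ∀ i, 0 < c i - θ := fun i => by linarith [hcθ i]
  have hs : ∀ i, 0 < b i - θ := fun i => by linarith [hs' i, hcb i]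
  have hTs : ∀ i, 0 < t - θ - (b i - θ) := fun i => by linarith [hblt i]
  have hgrow : ∀ i, ratio i * (1 + δ / (t - θ)) ≤ ratio (i + 1) := fun i => by
    refine ratio_growth (r := r (i + 1)) hθ hsum hprod hcrit hδ (hs' i)
      (by linarith [hcb i]) (by linarith [hblt i]) (by linarith [hcb (i + 1)]) (hs' (i + 1))
      (by linarith [hblt (i + 1)]) ?_ ?_
    · rw [add_sub_cancel, add_sub_cancel, hb]
    · rw [add_sub_cancel, add_sub_cancel, hc]
      linarith [hr (i + 1)]
  have hpow : ∀ i, ratio 0 * (1 + δ / (t - θ)) ^ i ≤ ratio i := by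
    intro i
    induction i with
    | zero => simp
    | succ i ih =>
      rw [pow_succ, ← mul_assoc]
      exact (mul_le_mul_of_nonneg_right ih (by positivity)).trans (hgrow i)
  have h0 : 0 < ratio 0 := by
    have : 0 < t - θ - (c 0 - θ) := by linarith [hTs 0, hcb 0]
    exact div_pos (mul_pos (hs 0) this) (mul_pos (hTs 0) (hs' 0))
  -- The denominator stays away from zero because `b i < θ + 1 / lam < t` and `c i > θ + δ * θ ^ 2`.
  have hbdd : ∀ i, ratio i ≤ (t - θ) * (t - θ) / ((t - θ - 1 / lam) * (δ * θ ^ 2)) := by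
    intro i
    have h1 : 0 < t - θ - 1 / lam := by linarith
    have h2 := hs' i
    refine div_le_div₀ (by positivity) (mul_le_mul ?_ ?_ ?_ hT.le) (by positivity)
      (mul_le_mul ?_ ?_ hε.le (hTs i).le)
    · linarith [hTs i]
    · linarith
    · linarith [hTs i, hcb i]
    · linarith [hblt i]
    · linarith [hcθ i]
  obtain ⟨n, hn⟩ := pow_unbounded_of_one_lt
    ((t - θ) * (t - θ) / ((t - θ - 1 / lam) * (δ * θ ^ 2)) / ratio 0)
    (by have : 0 < δ / (t - θ) := by positivity
        linarith : 1 < 1 + δ / (t - θ))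
  rw [div_lt_iff₀ h0] at hn
  linarith [hpow n, hbdd n]

/-! ### The critical value and the choice of leaf counts -/

theorem exists_fixed_points {lam : ℝ} (hlam : Real.sqrt (2 + Real.sqrt 5) < lam) :
    ∃ θ t : ℝ, 0 < θ ∧ θ < 1 ∧ t + θ = lam ∧ t * θ = 1 ∧ 1 / lam < t - θ := by
  have h0 : 0 < lam := (Real.sqrt_nonneg _).trans_lt hlam
  have hsq : 2 + Real.sqrt 5 < lam ^ 2 := (Real.sqrt_lt' h0).1 hlam
  have h5 : 2 < Real.sqrt 5 := (Real.lt_sqrt (by norm_num)).2 (by norm_num)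
  have h55 : Real.sqrt 5 ^ 2 = 5 := Real.sq_sqrt (by norm_num)
  set D := Real.sqrt (lam ^ 2 - 4) with hD
  have hD2 : D ^ 2 = lam ^ 2 - 4 := Real.sq_sqrt (by linarith)
  have hD0 : 0 < D := Real.sqrt_pos.2 (by linarith)
  have hDlam : D < lam := by nlinarith
  have hlam2 : 2 < lam := by nlinarith
  refine ⟨(lam - D) / 2, (lam + D) / 2, by linarith, ?_, by ring, by linarith, ?_⟩
  · nlinarith
  · have : (lam + D) / 2 - (lam - D) / 2 = D := by ring
    rw [this, div_lt_iff₀ h0]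
    -- This is `lam ^ 4 - 4 * lam ^ 2 > 1`, that is, `lam ^ 2 > 2 + √5`.
    have : 1 < (D * lam) ^ 2 := by
      rw [mul_pow, hD2]; nlinarith
    nlinarith [mul_pos hD0 h0]

/-- For `lam > √(2 + √5)` there are leaf counts for which the spine solution at `lam` stays positive
with ratio at least `1 / lam`, while at every smaller value it fails to be positive. -/
theorem exists_leaf_counts {lam : ℝ} (hlam : Real.sqrt (2 + Real.sqrt 5) < lam) :
    ∃ r : ℕ → ℕ, 1 ≤ r 0 ∧ (∀ i, 0 < spineSolution lam r (i + 1)) ∧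
      (∀ i, spineSolution lam r (i + 1) / lam ≤ spineSolution lam r (i + 2)) ∧
      ∀ lam', 0 < lam' → lam' < lam → ∃ i, spineSolution lam' r (i + 1) ≤ 0 := by
  have h0 : 0 < lam := (Real.sqrt_nonneg _).trans_lt hlam
  obtain ⟨θ, t, hθ, hθ1, hsum, hprod, hcrit⟩ := exists_fixed_points hlam
  have ht1 : 1 < t := by nlinarith
  obtain ⟨r, b, hbθ, hblt, hb0, hb, hr0⟩ := exists_greedy_leaf_counts h0 hθ hsum hprod
  have hsol : ∀ i, 0 < spineSolution lam r (i + 1) ∧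
      spineSolution lam r (i + 2) = b i * spineSolution lam r (i + 1) := by
    intro i
    induction i with
    | zero => simp [spineSolution, hb0]
    | succ i ih =>
      have hbi : 0 < b i := hθ.trans_le (hbθ i)
      have hpos : 0 < spineSolution lam r (i + 1 + 1) := by
        rw [ih.2]; exact mul_pos hbi ih.1
      refine ⟨hpos, ?_⟩
      rw [spineSolution, hb, sub_mul _ (1 / b i)]
      congr 1
      rw [ih.2]; field_simp
  refine ⟨r, hr0 (by nlinarith), fun i => (hsol i).1, fun i => ?_, fun lam' h0' hlt => ?_⟩
  -- The ratio is at least `θ`, and `lam * θ = 1 + θ ^ 2 ≥ 1`.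
  · rw [(hsol i).2, div_eq_inv_mul]
    refine mul_le_mul_of_nonneg_right (le_trans ?_ (hbθ i)) (hsol i).1.le
    rw [inv_le_iff_one_le_mul₀ h0]
    nlinarith
  · by_contra! hpos
    refine not_forall_pos_of_greedy (lam' := lam') (r := r)
      (c := fun i => spineSolution lam' r (i + 2) / spineSolution lam' r (i + 1))
      hθ hθ1 hsum hprod hcrit h0' hlt hblt hb0 hb (by simp [spineSolution]) (fun i => ?_)
      (fun i => div_pos (hpos (i + 1)) (hpos i))
    have h1 := (hpos i).ne'
    have h2 := (hpos (i + 1)).ne'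
    change spineSolution lam' r (i + 1 + 2) / spineSolution lam' r (i + 1 + 1) = _
    rw [spineSolution, one_div_div, sub_div, mul_div_cancel_right₀ _ h2]

/-! ### Trees and caterpillars -/

namespace SimpleGraph

/-- A graph whose edges join every vertex other than the root to its parent is a tree. -/
theorem isTree_of_parent {V : Type*} [Finite V] {G : SimpleGraph V} (root : V) (parent : V → V)
    (height : V → ℕ) (hheight : ∀ v, v ≠ root → height (parent v) < height v)
    (hadj : ∀ v, v ≠ root → G.Adj v (parent v))
    (hedge : ∀ u v, G.Adj u v → (u ≠ root ∧ parent u = v) ∨ (v ≠ root ∧ parent v = u)) :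
    G.IsTree := by
  classical
  have hreach : ∀ n v, height v ≤ n → G.Reachable v root := by
    intro n
    induction n with
    | zero =>
      intro v hv
      by_cases h : v = root
      · rw [h]
      · have := hheight v h; omega
    | succ n ih =>
      intro v hv
      by_cases h : v = root
      · rw [h]
      · have := hheight v h
        exact (hadj v h).reachable.trans (ih _ (by omega))
  have hconn : G.Connected := by
    have : Nonempty V := ⟨root⟩
    exact ⟨fun u v => (hreach _ u le_rfl).trans (hreach _ v le_rfl).symm⟩
  refine isTree_iff_connected_and_card.2
    ⟨hconn, le_antisymm ?_ hconn.card_vert_le_card_edgeSet_add_one⟩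
  let f : {v : V // v ≠ root} → G.edgeSet := fun v => ⟨s(v.1, parent v.1), hadj v.1 v.2⟩
  have hf : Function.Surjective f := by
    rintro ⟨e, he⟩
    induction e with
    | _ u v =>
      rcases hedge u v he with ⟨h, rfl⟩ | ⟨h, rfl⟩
      · exact ⟨⟨u, h⟩, rfl⟩
      · exact ⟨⟨v, h⟩, Subtype.ext Sym2.eq_swap⟩
  have h1 := Nat.card_le_card_of_surjective f hf
  have h2 : Nat.card {v : V // v ≠ root} + 1 = Nat.card V := by
    have := Fintype.ofFinite V
    have hp : 0 < Fintype.card V := Fintype.card_pos_iff.2 ⟨root⟩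
    rw [Nat.card_eq_fintype_card, Nat.card_eq_fintype_card, Fintype.card_subtype_compl,
      Fintype.card_subtype_eq]
    omega
  omega

theorem Iso.isPendantVertex_iff {V W : Type*} {G : SimpleGraph V} {H : SimpleGraph W} (f : G ≃g H)
    (v : V) : H.IsPendantVertex (f v) ↔ G.IsPendantVertex v := by
  unfold IsPendantVertex
  rw [← f.toEquiv.existsUnique_congr_right]
  simp [f.map_adj_iff]

/-- An isomorphism of graphs restricts to the subgraphs of non-pendant vertices. -/
def Iso.induceNonpendant {V W : Type*} {G : SimpleGraph V} {H : SimpleGraph W} (f : G ≃g H) :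
    G.induce {v | ¬ G.IsPendantVertex v} ≃g H.induce {v | ¬ H.IsPendantVertex v} where
  toEquiv := f.toEquiv.subtypeEquiv fun v => not_congr (f.isPendantVertex_iff v).symm
  map_rel_iff' := f.map_rel_iff

theorem IsCaterpillar.of_iso {V W : Type*} {G : SimpleGraph V} {H : SimpleGraph W} (f : G ≃g H)
    (hH : H.IsCaterpillar) : G.IsCaterpillar := by
  obtain ⟨hT, m, ⟨g⟩⟩ := hH
  refine ⟨f.isTree_iff.2 hT, m, ⟨g.comp (f.induceNonpendant)⟩⟩

end SimpleGraph

/-! ### Spectral radius bounds from test vectors -/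

namespace SignedGraph

/-- The signed graph all of whose edges are positive. -/
def ofGraph {V : Type*} (G : SimpleGraph V) : SignedGraph V := ⟨G, fun _ => 1⟩

open Classical in
theorem adjMatrix_ofGraph {V : Type*} (G : SimpleGraph V) (u v : V) :
    (ofGraph G).adjMatrix u v = if G.Adj u v then 1 else 0 := by
  by_cases h : G.Adj u v <;> simp [adjMatrix, ofGraph, h]

/-- For an eigenvector `y`, evaluate the eigenvalue equation where `|y v| / x v` is largest; the
nonnegative entries allow comparison with `x` there. -/
theorem spectralRadius_le_of_supersolution {V : Type*} [Fintype V] [DecidableEq V] [Nonempty V]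
    (G : SimpleGraph V) {lam : ℝ} {x : V → ℝ} (hx : ∀ v, 0 < x v)
    (h : ∀ v, ∑ w, (ofGraph G).adjMatrix v w * x w ≤ lam * x v) :
    (ofGraph G).spectralRadius ≤ lam := by
  obtain ⟨μ, hμ, hval⟩ := (isGreatest_spectralRadius (ofGraph G)).1
  rw [← hval]
  rw [← Matrix.spectrum_toLin', ← Module.End.hasEigenvalue_iff_mem_spectrum] at hμ
  obtain ⟨y, hy⟩ := hμ.exists_hasEigenvector
  have hy1 := hy.apply_eq_smul
  rw [Matrix.toLin'_apply] at hy1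
  obtain ⟨v, -, hv⟩ := Finset.exists_max_image Finset.univ (fun v => |y v| / x v)
    Finset.univ_nonempty
  have hle : ∀ w, |y w| ≤ |y v| / x v * x w := fun w => by
    rw [← div_le_iff₀ (hx w)]; exact hv w (Finset.mem_univ _)
  have hyv : 0 < |y v| := by
    by_contra! h0
    have h1 : |y v| = 0 := le_antisymm h0 (abs_nonneg _)
    refine hy.2 (funext fun w => ?_)
    have := hle w
    rw [h1, zero_div, zero_mul] at this
    exact abs_nonpos_iff.1 this
  have hA : ∀ u w, 0 ≤ (ofGraph G).adjMatrix u w := fun u w => by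
    rw [adjMatrix_ofGraph]; split_ifs <;> norm_num
  have hmain : |μ| * |y v| ≤ lam * |y v| := by
    calc |μ| * |y v| = |∑ w, (ofGraph G).adjMatrix v w * y w| := by
          rw [← abs_mul]
          congr 1
          exact (congrFun hy1 v).symm
      _ ≤ ∑ w, |(ofGraph G).adjMatrix v w * y w| := Finset.abs_sum_le_sum_abs _ _
      _ ≤ ∑ w, |y v| / x v * ((ofGraph G).adjMatrix v w * x w) := by
          refine Finset.sum_le_sum fun w _ => ?_
          rw [abs_mul, abs_of_nonneg (hA v w), mul_left_comm]
          exact mul_le_mul_of_nonneg_left (hle w) (hA v w)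
      _ ≤ |y v| / x v * (lam * x v) := by
          rw [← Finset.mul_sum]
          have := hx v
          exact mul_le_mul_of_nonneg_left (h v) (by positivity)
      _ = lam * |y v| := by have := (hx v).ne'; field_simp
  exact le_of_mul_le_mul_right hmain hyv

/-- A Rayleigh quotient bound: pair the inequality with `x` and use that `ρ - A` is positive
semidefinite, `A` being the signed adjacency matrix. -/
theorem le_spectralRadius_of_subsolution {V : Type*} [Fintype V] [DecidableEq V]
    (Γ : SignedGraph V) {lam : ℝ} {x : V → ℝ} (hx : ∀ v, 0 ≤ x v) (hx0 : ∃ v, x v ≠ 0)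
    (h : ∀ v, lam * x v ≤ ∑ w, Γ.adjMatrix v w * x w) :
    lam ≤ Γ.spectralRadius := by
  have : Nonempty V := ⟨hx0.choose⟩
  set ρ := Γ.spectralRadius with hρ
  have hpsd : (algebraMap ℝ (Matrix V V ℝ) ρ - Γ.adjMatrix).PosSemidef := by
    rw [Matrix.posSemidef_iff_isHermitian_and_spectrum_nonneg]
    refine ⟨Matrix.IsHermitian.sub ?_ Γ.adjMatrix_isHermitian, ?_⟩
    · rw [Algebra.algebraMap_eq_smul_one]
      ext i j; simp [Matrix.one_apply, eq_comm]
    · rw [← spectrum.singleton_sub_eq]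
      rintro _ ⟨_, rfl, μ, hμ, rfl⟩
      have := (isGreatest_spectralRadius Γ).2 ⟨μ, hμ, rfl⟩
      exact sub_nonneg.2 ((le_abs_self μ).trans this)
  have h1 := hpsd.dotProduct_mulVec_nonneg x
  rw [Matrix.sub_mulVec, dotProduct_sub, Algebra.algebraMap_eq_smul_one, Matrix.smul_mulVec,
    Matrix.one_mulVec, dotProduct_smul] at h1
  have h2 : lam * (x ⬝ᵥ x) ≤ x ⬝ᵥ (Γ.adjMatrix.mulVec x) := by
    simp only [dotProduct, Finset.mul_sum]
    refine Finset.sum_le_sum fun v _ => ?_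
    rw [mul_left_comm]
    exact mul_le_mul_of_nonneg_left (h v) (hx v)
  have h3 : 0 < x ⬝ᵥ x := by
    obtain ⟨v, hv⟩ := hx0
    exact Finset.sum_pos' (fun w _ => mul_self_nonneg _)
      ⟨v, Finset.mem_univ _, mul_self_pos.2 hv⟩
  simp only [star_trivial, smul_eq_mul] at h1
  exact le_of_mul_le_mul_right (by linarith) h3

theorem spectralRadius_ofGraph_comap {V W : Type*} [Fintype V] [DecidableEq V] [Fintype W]
    [DecidableEq W] (G : SimpleGraph W) (e : V ≃ W) :
    (ofGraph (G.comap e)).spectralRadius = (ofGraph G).spectralRadius := by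
  have : (ofGraph (G.comap e)).adjMatrix =
      Matrix.reindexAlgEquiv ℝ ℝ e.symm (ofGraph G).adjMatrix := by
    ext i j
    simp only [adjMatrix_ofGraph, Matrix.coe_reindexAlgEquiv, Matrix.reindex_apply,
      Matrix.submatrix_apply, Equiv.symm_symm]
    congr 1
  rw [spectralRadius, spectralRadius, _root_.spectralRadius, _root_.spectralRadius, this,
    AlgEquiv.spectrum_eq]

end SignedGraph

/-! ### The concrete caterpillars -/

/-- The caterpillar with spine `0, …, m - 1` and `l i` leaves attached to the spine vertex `i`. -/
def caterpillarGraph (m : ℕ) (l : ℕ → ℕ) : SimpleGraph (Fin m ⊕ (Σ i : Fin m, Fin (l i))) where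
  Adj
    | .inl i, .inl j => (i : ℕ) + 1 = j ∨ (j : ℕ) + 1 = i
    | .inl i, .inr p => p.1 = i
    | .inr p, .inl i => p.1 = i
    | .inr _, .inr _ => False
  symm := ⟨by rintro (i | p) (j | q) h <;> simp_all [or_comm]⟩
  loopless := ⟨by rintro (i | p) h <;> simp_all⟩

namespace caterpillarGraph

variable {m : ℕ} {l : ℕ → ℕ}

theorem adj_inl_inl {i j : Fin m} : (caterpillarGraph m l).Adj (.inl i) (.inl j) ↔
    (i : ℕ) + 1 = j ∨ (j : ℕ) + 1 = i := Iff.rfl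

theorem adj_inl_inr {i : Fin m} {p : Σ i : Fin m, Fin (l i)} :
    (caterpillarGraph m l).Adj (.inl i) (.inr p) ↔ p.1 = i := Iff.rfl

theorem adj_inr_inl {i : Fin m} {p : Σ i : Fin m, Fin (l i)} :
    (caterpillarGraph m l).Adj (.inr p) (.inl i) ↔ p.1 = i := Iff.rfl

theorem not_adj_inr_inr {p q : Σ i : Fin m, Fin (l i)} :
    ¬ (caterpillarGraph m l).Adj (.inr p) (.inr q) := id

theorem isTree (hm : 0 < m) : (caterpillarGraph m l).IsTree := by
  refine SimpleGraph.isTree_of_parent (.inl ⟨0, hm⟩)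
    (Sum.elim (fun i => .inl ⟨i - 1, by omega⟩) (fun p => .inl p.1))
    (Sum.elim (fun i => i) (fun p => p.1 + 1)) ?_ ?_ ?_
  · rintro (i | p) h
    · have : (i : ℕ) ≠ 0 := fun h0 => h (congrArg Sum.inl (Fin.ext h0))
      simp only [Sum.elim_inl]
      omega
    · simp
  · rintro (i | p) h
    · have : (i : ℕ) ≠ 0 := fun h0 => h (congrArg Sum.inl (Fin.ext h0))
      simp only [Sum.elim_inl, adj_inl_inl]
      omega
    · simp [adj_inr_inl]
  · rintro (i | p) (j | q) h
    · rw [adj_inl_inl] at h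
      simp only [ne_eq, Sum.inl.injEq, Fin.ext_iff, Sum.elim_inl]
      omega
    · right; rw [adj_inl_inr] at h; simp [h]
    · left; rw [adj_inr_inl] at h; simp [h]
    · exact absurd h not_adj_inr_inr

theorem isPendantVertex_inr (p : Σ i : Fin m, Fin (l i)) :
    (caterpillarGraph m l).IsPendantVertex (.inr p) := by
  refine ⟨.inl p.1, adj_inr_inl.2 rfl, ?_⟩
  rintro (i | q) h
  · rw [adj_inr_inl.1 h]
  · exact absurd h not_adj_inr_inr

/-- An end of the spine has a spine neighbour and a leaf; an interior vertex has two spine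
neighbours. -/
theorem not_isPendantVertex_inl (hm : 2 ≤ m) (h0 : 1 ≤ l 0) (h1 : 1 ≤ l (m - 1)) (i : Fin m) :
    ¬ (caterpillarGraph m l).IsPendantVertex (.inl i) := by
  intro h
  have hleaf : ∀ j : Fin m, 1 ≤ l i → (caterpillarGraph m l).Adj (.inl i) (.inl j) → False := by
    intro j hl hj
    have := h.unique hj (adj_inl_inr.2 rfl : (caterpillarGraph m l).Adj (.inl i)
      (.inr ⟨i, ⟨0, hl⟩⟩))
    simp at this
  by_cases hi0 : (i : ℕ) = 0
  · exact hleaf ⟨1, by omega⟩ (by rwa [hi0]) (adj_inl_inl.2 (by simp [hi0]))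
  by_cases him : (i : ℕ) = m - 1
  · exact hleaf ⟨i - 1, by omega⟩ (by rwa [him]) (adj_inl_inl.2 (by simp only; omega))
  have ha : (caterpillarGraph m l).Adj (.inl i) (.inl ⟨i - 1, by omega⟩) :=
    adj_inl_inl.2 (by simp only; omega)
  have hb : (caterpillarGraph m l).Adj (.inl i) (.inl ⟨i + 1, by omega⟩) :=
    adj_inl_inl.2 (by simp)
  have := h.unique ha hb
  simp only [Sum.inl.injEq, Fin.mk.injEq] at this
  omega

theorem isCaterpillar (hm : 2 ≤ m) (h0 : 1 ≤ l 0) (h1 : 1 ≤ l (m - 1)) :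
    (caterpillarGraph m l).IsCaterpillar := by
  refine ⟨isTree (by omega), m, ⟨SimpleGraph.Iso.symm ⟨Equiv.ofBijective
    (fun i => ⟨.inl i, not_isPendantVertex_inl hm h0 h1 i⟩) ⟨?_, ?_⟩, ?_⟩⟩⟩
  · intro i j h
    simpa using h
  · rintro ⟨i | p, hv⟩
    · exact ⟨i, rfl⟩
    · exact absurd (isPendantVertex_inr p) hv
  · intro i j
    rw [SimpleGraph.pathGraph_adj]
    exact adj_inl_inl (l := l)

/-- The sum of a function over the neighbours of a spine vertex. -/
theorem sum_adjMatrix_inl (f : ℕ → ℝ) (hf : f 0 = 0) (g : ℝ) (i : Fin m) :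
    ∑ w, (SignedGraph.ofGraph (caterpillarGraph m l)).adjMatrix (.inl i) w *
      Sum.elim (fun j : Fin m => f (j + 1)) (fun p => f (p.1 + 1) * g) w =
    f i + (if (i : ℕ) + 1 < m then f (i + 2) else 0) + l i * (f (i + 1) * g) := by
  classical
  rw [Fintype.sum_sum_type, Fintype.sum_sigma]
  simp only [SignedGraph.adjMatrix_ofGraph, adj_inl_inl, adj_inl_inr, Sum.elim_inl, Sum.elim_inr,
    ite_mul, one_mul, zero_mul, Finset.sum_const, Finset.card_univ, Fintype.card_fin,
    nsmul_eq_mul]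
  congr 1
  · have hsplit : ∀ j : Fin m, (if (i : ℕ) + 1 = j ∨ (j : ℕ) + 1 = i then f (j + 1) else 0) =
        (if (j : ℕ) + 1 = i then f i else 0) + (if (i : ℕ) + 1 = j then f (i + 2) else 0) := by
      intro j
      by_cases h1 : (i : ℕ) + 1 = j
      · have : ¬ (j : ℕ) + 1 = i := by omega
        rw [if_pos (Or.inl h1), if_neg this, if_pos h1, ← h1, zero_add]
      · by_cases h2 : (j : ℕ) + 1 = i <;> simp [h1, h2]
    rw [Finset.sum_congr rfl fun j _ => hsplit j, Finset.sum_add_distrib]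
    rw [Fin.sum_univ_eq_sum_range (fun j => if j + 1 = (i : ℕ) then f i else 0),
      Fin.sum_univ_eq_sum_range (fun j => if (i : ℕ) + 1 = j then f (i + 2) else 0),
      Finset.sum_ite_eq]
    simp only [Finset.mem_range]
    congr 1
    rcases Nat.eq_zero_or_pos (i : ℕ) with h | h
    · simp [h, hf]
    · rw [Finset.sum_eq_single ((i : ℕ) - 1)]
      · rw [if_pos (by omega)]
      · intro b _ hb; rw [if_neg (by omega)]
      · intro hb; exact absurd (Finset.mem_range.2 (by omega)) hb
  · simp

theorem sum_adjMatrix_inr (f : ℕ → ℝ) (g : ℝ) (p : Σ i : Fin m, Fin (l i)) :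
    ∑ w, (SignedGraph.ofGraph (caterpillarGraph m l)).adjMatrix (.inr p) w *
      Sum.elim (fun j : Fin m => f (j + 1)) (fun p => f (p.1 + 1) * g) w = f (p.1 + 1) := by
  classical
  rw [Fintype.sum_sum_type]
  simp [SignedGraph.adjMatrix_ofGraph, adj_inr_inl, not_adj_inr_inr]

end caterpillarGraph

/-! ### Bounds for the truncated caterpillars and conclusion -/

/-- The leaf counts of `r` up to the spine vertex `m - 1`, which gets one additional leaf. -/
def closingLeafCount (r : ℕ → ℕ) (m i : ℕ) : ℕ := if i + 1 = m then r i + 1 else r i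

/-- The spine solution solves the equation everywhere but at the last spine vertex, where the extra
leaf, of value `spineSolution lam r m / lam`, replaces a missing neighbour at least as large. -/
theorem spectralRadius_caterpillarGraph_le {lam : ℝ} (hlam : 0 < lam) {r : ℕ → ℕ} {m : ℕ}
    (hm : 0 < m) (hpos : ∀ i, 0 < spineSolution lam r (i + 1))
    (hratio : spineSolution lam r m / lam ≤ spineSolution lam r (m + 1)) :
    (SignedGraph.ofGraph (caterpillarGraph m
      (closingLeafCount r m))).spectralRadius ≤ lam := by
  have : Nonempty (Fin m) := ⟨⟨0, hm⟩⟩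
  refine SignedGraph.spectralRadius_le_of_supersolution _
    (x := Sum.elim (fun j => spineSolution lam r (j + 1))
      (fun p => spineSolution lam r (p.1 + 1) * lam⁻¹)) ?_ ?_
  · rintro (i | p)
    · exact hpos i
    · exact mul_pos (hpos p.1) (inv_pos.2 hlam)
  · rintro (i | p)
    · rw [caterpillarGraph.sum_adjMatrix_inl (spineSolution lam r) rfl]
      have hrec : spineSolution lam r (i + 2) =
        (lam - r i / lam) * spineSolution lam r (i + 1) - spineSolution lam r i := rfl
      simp only [Sum.elim_inl]
      rw [closingLeafCount]
      by_cases h : (i : ℕ) + 1 = m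
      · rw [if_neg (by omega), if_pos h]
        rw [← h, div_eq_mul_inv] at hratio
        push_cast
        rw [div_eq_mul_inv] at hrec
        linarith
      · rw [if_pos (by omega), if_neg h, hrec]
        apply le_of_eq
        ring
    · rw [caterpillarGraph.sum_adjMatrix_inr (spineSolution lam r), Sum.elim_inr, mul_left_comm,
        mul_inv_cancel₀ hlam.ne', mul_one]

theorem le_spectralRadius_caterpillarGraph {lam : ℝ} (hlam : 0 < lam) {r : ℕ → ℕ}
    (hneg : ∃ i, spineSolution lam r (i + 1) ≤ 0) :
    ∃ N, ∀ m, N ≤ m → lam ≤ (SignedGraph.ofGraph (caterpillarGraph m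
      (closingLeafCount r m))).spectralRadius := by
  classical
  obtain ⟨k, hk, hmin⟩ : ∃ k, spineSolution lam r (k + 1) ≤ 0 ∧
      ∀ j < k, 0 < spineSolution lam r (j + 1) :=
    ⟨Nat.find hneg, Nat.find_spec hneg, fun j hj => not_le.1 (Nat.find_min hneg hj)⟩
  have hk0 : k ≠ 0 := by rintro rfl; simp [spineSolution] at hk; linarith
  refine ⟨k, fun m hm => ?_⟩
  -- Spine vertex `i` carries `f (i + 1)`, so the support on the spine is the vertices before `k`.
  -- At vertex `k - 1` a nonpositive neighbour value is replaced by `0`, which only helps.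
  set f : ℕ → ℝ := fun n => if n ≤ k then spineSolution lam r n else 0 with hf
  have hf0 : f 0 = 0 := by simp [hf, spineSolution]
  have hfnn : ∀ n, 0 ≤ f n := by
    intro n
    simp only [hf]
    split_ifs with h
    · rcases n with _ | n
      · simp [spineSolution]
      · exact (hmin n (by omega)).le
    · exact le_rfl
  refine SignedGraph.le_spectralRadius_of_subsolution _
    (x := Sum.elim (fun j => f (j + 1)) (fun p => f (p.1 + 1) * lam⁻¹)) ?_ ?_ ?_
  · rintro (i | p)
    · exact hfnn _
    · exact mul_nonneg (hfnn _) (inv_pos.2 hlam).le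
  · refine ⟨.inl ⟨0, by omega⟩, ?_⟩
    simp [hf, spineSolution, hk0]
  · rintro (i | p)
    · rw [caterpillarGraph.sum_adjMatrix_inl _ hf0]
      simp only [Sum.elim_inl]
      have hrec : spineSolution lam r (i + 2) =
        (lam - r i / lam) * spineSolution lam r (i + 1) - spineSolution lam r i := rfl
      have hl : (r i : ℝ) ≤ (closingLeafCount r m i : ℝ) := by
        rw [closingLeafCount]; exact_mod_cast (by split_ifs <;> omega)
      have hlg := mul_le_mul_of_nonneg_right hl
        (mul_nonneg (hfnn (i + 1)) (inv_pos.2 hlam).le)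
      have hlast : 0 ≤ (if (i : ℕ) + 1 < m then f (i + 2) else 0) := by
        split_ifs
        · exact hfnn _
        · exact le_rfl
      rw [div_eq_mul_inv] at hrec
      by_cases hik : (i : ℕ) + 1 ≤ k
      · have e1 : f (i + 1) = spineSolution lam r (i + 1) := if_pos hik
        have e0 : f i = spineSolution lam r i := if_pos (by omega)
        have e2 : spineSolution lam r (i + 2) ≤ (if (i : ℕ) + 1 < m then f (i + 2) else 0) := by
          by_cases hk2 : (i : ℕ) + 2 ≤ k
          · rw [if_pos (by omega)]
            exact (if_pos hk2 : f (i + 2) = _).ge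
          · have : (i : ℕ) + 1 = k := by omega
            refine le_trans ?_ hlast
            rw [← this] at hk
            exact hk
        rw [e1] at hlg ⊢
        rw [e0]
        linarith
      · have e1 : f (i + 1) = 0 := if_neg hik
        rw [e1] at hlg ⊢
        linarith [hfnn i]
    · rw [caterpillarGraph.sum_adjMatrix_inr f, Sum.elim_inr, mul_left_comm,
        mul_inv_cancel₀ hlam.ne', mul_one]

theorem exists_caterpillar_spectralRadius_mem_Icc {lam lam' : ℝ}
    (hlam : Real.sqrt (2 + Real.sqrt 5) < lam) (h0 : 0 < lam') (hlt : lam' < lam) :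
    ∃ (n : ℕ) (Γ : SignedGraph (Fin n)), Γ.graph.IsCaterpillar ∧
      Γ.spectralRadius ∈ Set.Icc lam' lam := by
  obtain ⟨r, hr0, hpos, hratio, hsmall⟩ := exists_leaf_counts hlam
  obtain ⟨N, hN⟩ := le_spectralRadius_caterpillarGraph h0 (hsmall lam' h0 hlt)
  -- The `+ 2` gives the spine two distinct ends; the closing leaf makes the last one non-pendant.
  set l := closingLeafCount r (N + 2) with hl
  let e := (Fintype.equivFin (Fin (N + 2) ⊕ (Σ i : Fin (N + 2), Fin (l i)))).symm
  refine ⟨_, SignedGraph.ofGraph ((caterpillarGraph (N + 2) l).comap e), ?_, ?_⟩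
  · refine SimpleGraph.IsCaterpillar.of_iso (SimpleGraph.Iso.comap e _)
      (caterpillarGraph.isCaterpillar (by omega) ?_ ?_)
    · simpa [hl, closingLeafCount] using hr0
    · simp [hl, closingLeafCount]
  · rw [SignedGraph.spectralRadius_ofGraph_comap]
    exact ⟨hN _ (by omega), spectralRadius_caterpillarGraph_le (h0.trans hlt) (by omega) hpos
      (hratio (N + 1))⟩

theorem mainTheorem9 (lam : ℝ) (hlam : Real.sqrt (2 + Real.sqrt 5) ≤ lam) :
    ∃ (n : ℕ → ℕ) (Γ : (k : ℕ) → SignedGraph (Fin (n k))),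
      (∀ k, (Γ k).graph.IsCaterpillar) ∧
      (∀ i j, i ≠ j → (Γ i).spectralRadius ≠ (Γ j).spectralRadius) ∧
      Tendsto (fun k => (Γ k).spectralRadius) atTop (𝓝 lam) := by
  have h0 : 0 ≤ lam := (Real.sqrt_nonneg _).trans hlam
  let S : Set ℝ := {ρ | lam < ρ ∧ ∃ (n : ℕ) (Γ : SignedGraph (Fin n)), Γ.graph.IsCaterpillar ∧
    Γ.spectralRadius = ρ}
  have hS : ∀ ε, 0 < ε → ∃ ρ ∈ S, ρ ≤ lam + ε := by
    intro ε hε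
    obtain ⟨n, Γ, hΓ, h⟩ := exists_caterpillar_spectralRadius_mem_Icc
      (lam := lam + ε) (lam' := lam + ε / 2) (by linarith) (by linarith) (by linarith)
    exact ⟨_, ⟨by linarith [h.1], n, Γ, hΓ, rfl⟩, h.2⟩
  have hglb : IsGLB S lam := by
    refine ⟨fun ρ hρ => hρ.1.le, fun b hb => le_of_forall_pos_le_add fun ε hε => ?_⟩
    obtain ⟨ρ, hρ, hle⟩ := hS ε hε
    exact (hb hρ).trans hle
  obtain ⟨u, hanti, -, hlim, hmem⟩ := hglb.exists_seq_strictAnti_tendsto_of_notMem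
    (fun h => lt_irrefl _ h.1) (let ⟨ρ, hρ, _⟩ := hS 1 one_pos; ⟨ρ, hρ⟩)
  choose n Γ hΓ hu using fun k => (hmem k).2
  refine ⟨n, Γ, hΓ, fun i j hij => ?_, ?_⟩
  · rw [hu, hu]
    exact hanti.injective.ne hij
  · simpa only [hu] using hlim
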